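/- **Setting.** Let $\langle\cdot,\cdot\rangle$ be the inner product of $L^2(\mathbb R^N;\mathbb R^d)$, and let $\mathbf M$ be a self-adjoint positive-definite operator on it (bounded below by a positive constant, so that $\mathbf M^{-1}$ is bounded). Let $V$ be its energy space, the completion of the domain of $\mathbf M$ in the norm $\langle \mathbf M v,v\rangle^{1/2}$ (a subspace of $L^2$), and let $V'\supset L^2$ be the dual of $V$, with the pairing of $V'$ and $V$, also written $\langle\cdot,\cdot\rangle$, extending the $L^2$ inner product. Then $\mathbf M$ extends to an isomorphism $V\to V'$. Let $\mathbf L_0:V\to V'$ be a (nonlinear) map, let $\mathbf u\in V$ satisfy $\mathbf L_0\mathbf u=0$, and let $\mathbf L_0$ be continuously differentiable near $\mathbf u$. Write $\mathbf L_1$ for the derivative of $\mathbf L_0$ (at $\mathbf u$, unless another point is indicated), $\mathbf L_1^\dagger$ for its adjoint, and $$\mathcal L=-\mathbf M^{-1}\mathbf L_1^\dagger\mathbf M^{-1}\mathbf L_1 ,$$ a bounded operator on $V$, self-adjoint and $\le 0$ for the inner product $\langle \mathbf M\cdot,\cdot\rangle$; let $\Lambda_{\min}$ be the minimum of its spectrum.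 Assume that the spectrum of $\mathcal L$ apart from $0$ is bounded away from $0$. **Assumption 1.** $\mathbf u=\mathbf u(\cdot;c^0)$ belongs to a family $\mathbf u(\cdot;c)\in V$ of solutions of $\mathbf L_0\mathbf u=0$, continuously differentiable in $c=(c_1,\dots,c_s)$ near $c^0\in\mathbb R^s$ ($s\ge 0$), and the kernel of $\mathbf L_1$ is spanned by the invariance modes $\partial\mathbf u/\partial c_j|_{c=c^0}$, $1\le j\le s$. **Method (MSOM).** For $\Delta t>0$ and maps $\mathbf G_n:V\to V$ with $\|\mathbf G_n(\mathbf w)-\mathbf G_0\|_V\le C\|\mathbf w-\mathbf u\|_V$ for all $n$ and all $\mathbf w$ near $\mathbf u$ (here $\mathbf G_0\in V$ denotes the leading-order term), let, with $\mathbf G_n=\mathbf G_n(\mathbf u_n)$ and with $\mathbf L_1,\mathbf L_1^\dagger$ taken at $\mathbf u_n$, $$\mathbf u_{n+1}=\mathbf u_n-\left[\mathbf M^{-1}\mathbf L_1^\dagger\mathbf M^{-1}\mathbf L_0\mathbf u_n-\alpha_n\langle\mathbf G_n,\mathbf L_1^\dagger\mathbf M^{-1}\mathbf L_0\mathbf u_n\rangle\mathbf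 G_n\right]\Delta t,\qquad \alpha_n=\frac1{\langle\mathbf M\mathbf G_n,\mathbf G_n\rangle}-\frac1{\langle\mathbf L_1\mathbf G_n,\mathbf M^{-1}\mathbf L_1\mathbf G_n\rangle\Delta t}.$$ **Theorem.** Let Assumption 1 hold, let $\mathbf L_1\mathbf G_0\ne0$, and let $$0<\Delta t<\Delta t_M=\min\left(-\frac2{\Lambda_{\min}},\ \frac1{\frac{\langle\mathbf M\mathbf G_0,\mathcal L\mathbf G_0\rangle}{\langle\mathbf M\mathbf G_0,\mathbf G_0\rangle}-\Lambda_{\min}}\right),$$ where the second term is $+\infty$ if its denominator is $0$. Put $$\mathcal L_M\Psi=\mathcal L\Psi-\alpha_0\langle\mathbf M\mathbf G_0,\mathcal L\Psi\rangle\mathbf G_0,\qquad \alpha_0=\frac1{\langle\mathbf M\mathbf G_0,\mathbf G_0\rangle}+\frac1{\langle\mathbf M\mathbf G_0,\mathcal L\mathbf G_0\rangle\Delta t}.$$ Then: 1. every complex eigenvalue $\Lambda_M$ of $\mathcal L_M$ is real and non-positive, and $|1+\Lambda_M\Delta t|<1$ if $\Lambda_M\neq0$; 2. $\ker\mathcal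 L_M=\ker\mathbf L_1$, and $\mathcal L_M$ has no generalized eigenfunctions at zero: $\mathcal L_M^2\mathbf F=0$ implies $\mathcal L_M\mathbf F=0$; 3. the MSOM converges to the solitary wave from nearby initial data: for every $\varepsilon>0$ there is $\delta>0$ such that, whenever $\|\mathbf u_{n=0}-\mathbf u\|_V<\delta$, where $\mathbf u_{n=0}$ is the initial iterate, the denominators in $\alpha_n$ never vanish and the iterates converge in $V$ to a solution $\mathbf u(\cdot;c)$ of $\mathbf L_0\mathbf u=0$ with $|c-c^0|<\varepsilon$ (to $\mathbf u$ itself, if $s=0$). -/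

import Mathlib

open Filter Topology MeasureTheory
open scoped RealInnerProductSpace ENNReal

noncomputable section

/-- The space `L²(ℝᴺ; ℝᵈ)` of real, vector-valued, square-integrable functions, with its standard
inner product `⟪F₁, F₂⟫ = ∫ F₁ · F₂ dx`. -/
abbrev L2Space (N d : ℕ) : Type :=
  Lp (EuclideanSpace ℝ (Fin d)) 2 (volume : Measure (EuclideanSpace ℝ (Fin N)))

/-- An acceleration operator: a (possibly unbounded) self-adjoint operator on a real Hilbert space
which is positive definite, i.e. bounded below by a positive constant, so that its inverse is
an everywhere defined bounded operator. -/
structure AccelerationOperator (H : Type*) [NormedAddCommGroup H] [InnerProductSpace ℝ H]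
    [CompleteSpace H] where
  /-- the operator together with its domain -/
  op : H →ₗ.[ℝ] H
  selfAdjoint : IsSelfAdjoint op
  posDef : ∃ m : ℝ, 0 < m ∧ ∀ x : op.domain, m * ‖(x : H)‖ ^ 2 ≤ ⟪op x, (x : H)⟫

namespace AccelerationOperator

variable {H : Type*} [NormedAddCommGroup H] [InnerProductSpace ℝ H] [CompleteSpace H]

/-! ### The energy space of `M` -/

/-- The domain of `M`, to be equipped with the inner product `⟪M x, y⟫`. -/
def Dom (M : AccelerationOperator H) : Type _ := M.op.domain

instance (M : AccelerationOperator H) : AddCommGroup M.Dom :=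
  inferInstanceAs (AddCommGroup M.op.domain)

instance (M : AccelerationOperator H) : Module ℝ M.Dom :=
  inferInstanceAs (Module ℝ M.op.domain)

/-- The inclusion of the domain of `M` in the Hilbert space. -/
def domIncl (M : AccelerationOperator H) : M.Dom →ₗ[ℝ] H := M.op.domain.subtype

/-- `M` as a linear map on its domain. -/
def domOp (M : AccelerationOperator H) : M.Dom →ₗ[ℝ] H := M.op.toFun

theorem dense_domain (M : AccelerationOperator H) : Dense (M.op.domain : Set H) :=
  M.selfAdjoint.dense_domain

theorem symm_op (M : AccelerationOperator H) (x y : M.Dom) :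
    ⟪M.domOp x, M.domIncl y⟫ = ⟪M.domIncl x, M.domOp y⟫ := by
  have h := LinearPMap.adjoint_isFormalAdjoint M.dense_domain
  rw [show LinearPMap.adjoint M.op = M.op from M.selfAdjoint] at h
  exact h x y

theorem domIncl_injective (M : AccelerationOperator H) : Function.Injective M.domIncl :=
  Subtype.val_injective

/-- The energy inner product `⟪M x, y⟫` on the domain of `M`. -/
@[reducible] def core (M : AccelerationOperator H) : InnerProductSpace.Core ℝ M.Dom where
  inner x y := ⟪M.domOp x, M.domIncl y⟫
  conj_inner_symm x y := by
    simp only [conj_trivial]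
    rw [M.symm_op, real_inner_comm]
  re_inner_nonneg x := by
    obtain ⟨m, hm, h⟩ := M.posDef
    exact le_trans (by positivity) (h x)
  add_left x y z := by simp [inner_add_left]
  smul_left x y r := by simp [inner_smul_left]
  definite x hx := by
    obtain ⟨m, hm, h⟩ := M.posDef
    have h1 : m * ‖M.domIncl x‖ ^ 2 ≤ 0 := (h x).trans (le_of_eq hx)
    have h2 : ‖M.domIncl x‖ = 0 := by
      by_contra hne
      have : 0 < m * ‖M.domIncl x‖ ^ 2 := by positivity
      linarith
    exact M.domIncl_injective (by simpa using h2)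

instance (M : AccelerationOperator H) : NormedAddCommGroup M.Dom := M.core.toNormedAddCommGroup

instance (M : AccelerationOperator H) : InnerProductSpace ℝ M.Dom :=
  InnerProductSpace.ofCore M.core.toCore

/-- The energy space (form domain) of `M`: the completion of the domain of `M` for the norm
`⟪M x, x⟫ ^ (1/2)`.  By `toAmbient` and `toAmbient_injective` it is a space of elements
of the ambient Hilbert space. -/
def Energy (M : AccelerationOperator H) : Type _ := UniformSpace.Completion M.Dom

instance (M : AccelerationOperator H) : NormedAddCommGroup M.Energy :=
  inferInstanceAs (NormedAddCommGroup (UniformSpace.Completion M.Dom))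

instance (M : AccelerationOperator H) : InnerProductSpace ℝ M.Energy :=
  inferInstanceAs (InnerProductSpace ℝ (UniformSpace.Completion M.Dom))

instance (M : AccelerationOperator H) : CompleteSpace M.Energy :=
  inferInstanceAs (CompleteSpace (UniformSpace.Completion M.Dom))

/-- The canonical isometric map of the domain of `M` into the energy space, with dense range. -/
def ofDom (M : AccelerationOperator H) : M.Dom →ₗᵢ[ℝ] M.Energy :=
  (UniformSpace.Completion.toComplₗᵢ : M.Dom →ₗᵢ[ℝ] UniformSpace.Completion M.Dom)

theorem denseRange_ofDom (M : AccelerationOperator H) : DenseRange M.ofDom :=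
  UniformSpace.Completion.denseRange_coe

/-- The dual of the energy space.  Through `ofAmbient` it contains the ambient Hilbert space, and
the evaluation `f v` of `f : M.EnergyDual` at `v : M.Energy` extends the inner product of the
ambient Hilbert space. -/
abbrev EnergyDual (M : AccelerationOperator H) : Type _ := StrongDual ℝ M.Energy

theorem inner_dom (M : AccelerationOperator H) (x y : M.Dom) :
    ⟪x, y⟫ = ⟪M.domOp x, M.domIncl y⟫ := rfl

theorem exists_bound (M : AccelerationOperator H) :
    ∃ C : ℝ, ∀ x : M.Dom, ‖M.domIncl x‖ ≤ C * ‖x‖ := by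
  obtain ⟨m, hm, h⟩ := M.posDef
  refine ⟨(Real.sqrt m)⁻¹, fun x => ?_⟩
  have h1 : m * ‖M.domIncl x‖ ^ 2 ≤ ‖x‖ ^ 2 := by
    rw [← real_inner_self_eq_norm_sq x, inner_dom]
    exact h x
  have h2 : Real.sqrt m * ‖M.domIncl x‖ ≤ ‖x‖ := by
    apply le_of_sq_le_sq _ (norm_nonneg _)
    rw [mul_pow, Real.sq_sqrt hm.le]
    exact h1
  rw [inv_mul_eq_div, le_div_iff₀ (Real.sqrt_pos.mpr hm), mul_comm]
  exact h2

/-- The domain inclusion as a bounded map for the energy norm. -/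
def domInclL (M : AccelerationOperator H) : M.Dom →L[ℝ] H :=
  M.domIncl.mkContinuousOfExistsBound M.exists_bound

/-- The canonical inclusion of the energy space in the ambient Hilbert space. -/
def toAmbient (M : AccelerationOperator H) : M.Energy →L[ℝ] H :=
  M.domInclL.extend M.ofDom.toContinuousLinearMap

theorem toAmbient_ofDom (M : AccelerationOperator H) (x : M.Dom) :
    M.toAmbient (M.ofDom x) = M.domIncl x :=
  ContinuousLinearMap.extend_eq _ M.denseRange_ofDom M.ofDom.isometry.isUniformInducing x

theorem inner_ofDom_left (M : AccelerationOperator H) (x : M.Dom) (v : M.Energy) :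
    ⟪M.ofDom x, v⟫ = ⟪M.domOp x, M.toAmbient v⟫ := by
  refine M.denseRange_ofDom.induction_on v (isClosed_eq (by fun_prop) (by fun_prop)) fun y => ?_
  rw [LinearIsometry.inner_map_map, toAmbient_ofDom, inner_dom]

theorem toAmbient_injective (M : AccelerationOperator H) : Function.Injective M.toAmbient := by
  rw [injective_iff_map_eq_zero]
  intro v hv
  have h : ∀ w : M.Energy, ⟪w, v⟫ = 0 := by
    intro w
    refine M.denseRange_ofDom.induction_on w (isClosed_eq (by fun_prop) (by fun_prop)) fun x => ?_
    rw [inner_ofDom_left, hv, inner_zero_right]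
  exact inner_self_eq_zero.mp (h v)

/-- The canonical map of the ambient Hilbert space into the dual of the energy space,
`f ↦ ⟪f, ·⟫`. -/
def ofAmbient (M : AccelerationOperator H) (f : H) : M.EnergyDual :=
  (innerSL ℝ f).comp M.toAmbient

/-- `M` as an isomorphism of the energy space onto its dual. -/
def toDual (M : AccelerationOperator H) : M.Energy ≃L[ℝ] M.EnergyDual where
  toFun v := InnerProductSpace.toDual ℝ M.Energy v
  map_add' v w := by simp
  map_smul' r v := by simp
  invFun f := (InnerProductSpace.toDual ℝ M.Energy).symm f
  left_inv v := by simp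
  right_inv f := by simp
  continuous_toFun := (InnerProductSpace.toDual ℝ M.Energy).continuous
  continuous_invFun := (InnerProductSpace.toDual ℝ M.Energy).symm.continuous

theorem toDual_apply (M : AccelerationOperator H) (v w : M.Energy) :
    M.toDual v w = ⟪v, w⟫ := by
  simp [toDual]

/-- The isomorphism `toDual` extends the operator `M` from its domain. -/
theorem toDual_ofDom (M : AccelerationOperator H) (x : M.Dom) :
    M.toDual (M.ofDom x) = M.ofAmbient (M.domOp x) := by
  ext v
  rw [toDual_apply, inner_ofDom_left]
  simp [ofAmbient]

/-- The bounded operator `M⁻¹`, from the dual of the energy space to the energy space. -/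
def inv (M : AccelerationOperator H) : M.EnergyDual →L[ℝ] M.Energy :=
  (M.toDual.symm : M.EnergyDual →L[ℝ] M.Energy)

/-! ### The linearized operators and the iteration

In what follows `L₀` maps the energy space to its dual; the evaluation `f v` is the
(extended) inner product of `f` and `v`. -/

variable (M : AccelerationOperator H) (L₀ : M.Energy → M.EnergyDual)

/-- The linearization `L₁` of `L₀` around `w`. -/
def L₁ (w : M.Energy) : M.Energy →L[ℝ] M.EnergyDual := fderiv ℝ L₀ w

/-- The Hermitian adjoint of `L₁`: `⟨L₁† v, h⟩ = ⟨v, L₁ h⟩`. -/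
def L₁adj (w : M.Energy) : M.Energy →L[ℝ] M.EnergyDual := (M.L₁ L₀ w).flip

/-- The operator `𝓛 = - M⁻¹ L₁† M⁻¹ L₁` around `u`. -/
def calL (u : M.Energy) : M.Energy →L[ℝ] M.Energy :=
  -(M.inv ∘L M.L₁adj L₀ u ∘L M.inv ∘L M.L₁ L₀ u)

/-- The minimum `Λ_min` of the spectrum of `𝓛`. -/
def lamMin (u : M.Energy) : ℝ := sInf (spectrum ℝ (M.calL L₀ u))

/-- The coefficient `α = 1 / ⟨M G, G⟩ - 1 / (⟨L₁ G, M⁻¹ L₁ G⟩ Δt)`, with `L₁` taken at `w`. -/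
def alpha (Δt : ℝ) (w G : M.Energy) : ℝ :=
  1 / M.toDual G G - 1 / (M.L₁ L₀ w G (M.inv (M.L₁ L₀ w G)) * Δt)

/-- One step of the modified squared-operator method from `w` with the function `G`. -/
def msomStep (Δt : ℝ) (w G : M.Energy) : M.Energy :=
  w - Δt • (M.inv (M.L₁adj L₀ w (M.inv (L₀ w)))
    - (M.alpha L₀ Δt w G * M.L₁adj L₀ w (M.inv (L₀ w)) G) • G)

/-- The sequence `w` is produced by the modified squared-operator method with the functions
`Gₙ = G n (w n)`. -/
def IsMSOM (Δt : ℝ) (G : ℕ → M.Energy → M.Energy) (w : ℕ → M.Energy) : Prop :=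
  ∀ n, w (n + 1) = M.msomStep L₀ Δt (w n) (G n (w n))

/-- The coefficient `α₀ = 1 / ⟨M G₀, G₀⟩ + 1 / (⟨M G₀, 𝓛 G₀⟩ Δt)`. -/
def alpha₀ (Δt : ℝ) (u G₀ : M.Energy) : ℝ :=
  1 / M.toDual G₀ G₀ + 1 / (M.toDual G₀ (M.calL L₀ u G₀) * Δt)

/-- The linearized iteration operator `𝓛_M Ψ = 𝓛 Ψ - α₀ ⟨M G₀, 𝓛 Ψ⟩ G₀`. -/
def calLM (Δt : ℝ) (u G₀ : M.Energy) : M.Energy →L[ℝ] M.Energy :=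
  M.calL L₀ u - M.alpha₀ L₀ Δt u G₀ • ((M.toDual G₀ ∘L M.calL L₀ u).smulRight G₀)

/-- The threshold
`Δt_M = min (-2 / Λ_min) (1 / (⟨M G₀, 𝓛 G₀⟩ / ⟨M G₀, G₀⟩ - Λ_min))`, with values in `[0, ∞]`:
both denominators are nonnegative, and the second term is `∞` when its denominator vanishes. -/
def stepBound (u G₀ : M.Energy) : ℝ≥0∞ :=
  min (2 / ENNReal.ofReal (-M.lamMin L₀ u))
    (1 / ENNReal.ofReal
      (M.toDual G₀ (M.calL L₀ u G₀) / M.toDual G₀ G₀ - M.lamMin L₀ u))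

/-- `U` is a (local, continuously differentiable) `s`-parameter family of solutions of `L₀ u = 0`
through `u = U c₀`, and the kernel of the linearization `L₁` around `u` is spanned by the
invariance modes `∂U/∂c_j`. -/
structure KernelAssumption {s : ℕ} (U : EuclideanSpace ℝ (Fin s) → M.Energy)
    (c₀ : EuclideanSpace ℝ (Fin s)) : Prop where
  smooth : ContDiffAt ℝ 1 U c₀
  solution : ∀ᶠ c in 𝓝 c₀, L₀ (U c) = 0
  kernel : (M.L₁ L₀ (U c₀)).ker =
    Submodule.span ℝ (Set.range fun j : Fin s => fderiv ℝ U c₀ (EuclideanSpace.single j 1))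

/-- Apart from zero, the spectrum of `𝓛` (which is real and nonpositive) stays away from zero. -/
def SpectralGap (u : M.Energy) : Prop :=
  ∃ γ : ℝ, 0 < γ ∧ ∀ Λ ∈ spectrum ℝ (M.calL L₀ u), Λ ≠ 0 → Λ ≤ -γ

/-- `z` is an eigenvalue of (the complexification of) the real operator `T`: the function
`x + i y` is a nonzero eigenfunction. -/
def IsComplexEigenvalue {V : Type*} [AddCommGroup V] [Module ℝ V] (T : V →ₗ[ℝ] V) (z : ℂ) :
    Prop :=
  ∃ x y : V, (x ≠ 0 ∨ y ≠ 0) ∧ T x = z.re • x - z.im • y ∧ T y = z.im • x + z.re • y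

end AccelerationOperator

end

/-! ### Self-adjoint operators: spectrum, quadratic form and norm. -/

section SelfAdjoint

variable {V : Type*} [NormedAddCommGroup V] [InnerProductSpace ℝ V] [CompleteSpace V]

/-! On the energy space `V` put `F = M⁻¹ L₀` and `A = M⁻¹ L₁`. Since `M⁻¹` is the Riesz isomorphism,
`𝓛 = -A†A`, and the method reads `w ↦ w - τ Q F(w)` with `Q = A† - α ⟪A g, ·⟫ g`. The linearized
operator `𝓛_M = -Q A` need not be symmetric, so the argument follows the residual `F(w)` rather than
the error: to first order it is multiplied by `S = 1 - τ A Q`, which is symmetric because `A Q = A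
A† - α ⟪A g, ·⟫ A g`.

The spectral gap and the two step bounds confine the quadratic form of `S` on the range of `A` to
`[-ρ, ρ]` with `ρ < 1`, so `S` contracts there (`exists_norm_residualPropagator_le`). The relation
`S A = A (1 + τ 𝓛_M)` carries this to the eigenvalues and the kernel of `𝓛_M`.

For convergence, `HasStrictFDerivAt.exists_orthogonal_parameter` picks a solution near `w` whose
difference from `w` is orthogonal to `ker A`. There `A` is coercive by the gap, so `F(w)` lies in
the range of `A` up to `o(F(w))`, and the nonlinear residual contracts
(`eventually_norm_residual_le`). Steps are bounded by a multiple of the residual, so the iterates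
are Cauchy, and zeros of `F` near `u` all belong to the family. -/

theorem IsSelfAdjoint.norm_le_of_spectrum_le {S : V →L[ℝ] V} (hS : IsSelfAdjoint S) {c : ℝ}
    (hc : 0 ≤ c) (h : ∀ k ∈ spectrum ℝ S, |k| ≤ c) : ‖S‖ ≤ c := by
  have h1 : spectralRadius ℝ S ≤ ENNReal.ofReal c := by
    refine iSup₂_le fun k hk => ?_
    rw [← enorm_eq_nnnorm, ← ofReal_norm]
    exact ENNReal.ofReal_le_ofReal (h k hk)
  have h2 : spectralRadius ℝ S = ‖S‖₊ := ContinuousLinearMap.spectralRadius_eq_nnnorm S hS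
  rw [h2, ← enorm_eq_nnnorm, ← ofReal_norm] at h1
  exact (ENNReal.ofReal_le_ofReal_iff hc).1 h1

/-- The shift `‖S‖ - S` has spectrum in `[0, ‖S‖ - sInf]`, hence norm at most the right endpoint;
Cauchy–Schwarz for its quadratic form gives the bound. -/
theorem IsSelfAdjoint.sInf_spectrum_mul_norm_sq_le {S : V →L[ℝ] V} (hS : IsSelfAdjoint S) (x : V) :
    sInf (spectrum ℝ S) * ‖x‖ ^ 2 ≤ ⟪S x, x⟫ := by
  rcases subsingleton_or_nontrivial V with hV | hV
  · simp [Subsingleton.elim x 0]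
  have hbd : ∀ k ∈ spectrum ℝ S, |k| ≤ ‖S‖ := fun k hk => spectrum.norm_le_norm_of_mem hk
  have hbelow : BddBelow (spectrum ℝ S) := ⟨-‖S‖, fun k hk => (abs_le.1 (hbd k hk)).1⟩
  have hinf : sInf (spectrum ℝ S) ≤ ‖S‖ := by
    rcases (spectrum ℝ S).eq_empty_or_nonempty with he | ⟨k, hk⟩
    · simp [he]
    · exact (csInf_le hbelow hk).trans (abs_le.1 (hbd k hk)).2
  have hT : IsSelfAdjoint (algebraMap ℝ (V →L[ℝ] V) ‖S‖ - S) :=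
    (IsSelfAdjoint.algebraMap _ (IsSelfAdjoint.all _)).sub hS
  have hnorm : ‖algebraMap ℝ (V →L[ℝ] V) ‖S‖ - S‖ ≤ ‖S‖ - sInf (spectrum ℝ S) := by
    refine hT.norm_le_of_spectrum_le (sub_nonneg.2 hinf) fun k hk => ?_
    rw [← spectrum.singleton_sub_eq] at hk
    obtain ⟨_, rfl, t, ht, rfl⟩ := hk
    have h1 := (abs_le.1 (hbd t ht)).2
    have h2 := csInf_le hbelow ht
    simp only [abs_of_nonneg (sub_nonneg.2 h1)]
    linarith
  have h1 : ⟪(algebraMap ℝ (V →L[ℝ] V) ‖S‖ - S) x, x⟫ ≤ (‖S‖ - sInf (spectrum ℝ S)) * ‖x‖ ^ 2 :=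
    calc _ ≤ ‖(algebraMap ℝ (V →L[ℝ] V) ‖S‖ - S) x‖ * ‖x‖ := real_inner_le_norm _ _
      _ ≤ (‖S‖ - sInf (spectrum ℝ S)) * ‖x‖ * ‖x‖ := by
        gcongr
        exact ContinuousLinearMap.le_of_opNorm_le _ hnorm x
      _ = _ := by ring
  have h2 : ⟪(algebraMap ℝ (V →L[ℝ] V) ‖S‖ - S) x, x⟫ = ‖S‖ * ‖x‖ ^ 2 - ⟪S x, x⟫ := by
    simp [Algebra.algebraMap_eq_smul_one, inner_sub_left, inner_smul_left]
  linarith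

/-- A self-adjoint operator whose nonzero spectrum is at least `γ` satisfies `γ B ≤ B²`. -/
theorem IsSelfAdjoint.gap_mul_inner_le {B : V →L[ℝ] V} (hB : IsSelfAdjoint B) {γ : ℝ} (hγ : 0 < γ)
    (h : ∀ k ∈ spectrum ℝ B, k ≠ 0 → γ ≤ k) (x : V) : γ * ⟪B x, x⟫ ≤ ‖B x‖ ^ 2 := by
  -- Shifting to the middle of the gap `(0, γ)` keeps the spectrum at distance `γ / 2` from zero, so
  -- `‖T x‖ ≥ (γ / 2) ‖x‖`. On expanding the square, the `‖x‖²` terms cancel and the claim remains.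
  set T : V →L[ℝ] V := B - algebraMap ℝ (V →L[ℝ] V) (γ / 2) with hTdef
  have hT : IsSelfAdjoint T := hB.sub (IsSelfAdjoint.algebraMap _ (IsSelfAdjoint.all _))
  have hspec : ∀ k ∈ spectrum ℝ T, γ / 2 ≤ |k| := by
    intro k hk
    rw [hTdef, ← spectrum.sub_singleton_eq] at hk
    obtain ⟨t, ht, _, rfl, rfl⟩ := hk
    by_cases h0 : t = 0
    · simpa [h0] using le_abs_self (γ / 2)
    · have := h t ht h0
      exact (by linarith : γ / 2 ≤ t - γ / 2).trans (le_abs_self _)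
  have hunit : IsUnit T := by
    rw [← spectrum.zero_notMem_iff ℝ]
    intro h0
    have := hspec 0 h0
    simp at this
    linarith
  obtain ⟨W, hW⟩ := hunit
  have hWsa : IsSelfAdjoint (↑W⁻¹ : V →L[ℝ] V) := by
    have h1 : star W = W := Units.ext (by rw [Units.coe_star, hW]; exact hT)
    have h2 : star W⁻¹ = W⁻¹ := by rw [star_inv, h1]
    exact congrArg Units.val h2
  have hnorm : ‖(↑W⁻¹ : V →L[ℝ] V)‖ ≤ 2 / γ := by
    refine hWsa.norm_le_of_spectrum_le (by positivity) fun k hk => ?_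
    rw [← spectrum.map_inv, Set.mem_inv, hW] at hk
    have h1 := hspec _ hk
    have hk0 : k ≠ 0 := by
      rintro rfl
      simp at h1
      linarith
    rw [abs_inv] at h1
    have := inv_anti₀ (by positivity) h1
    rw [inv_inv] at this
    rwa [← inv_div]
  have hx : γ / 2 * ‖x‖ ≤ ‖T x‖ := by
    have h1 : x = (↑W⁻¹ : V →L[ℝ] V) (T x) := by
      rw [← hW, ← mul_apply_eq_comp, Units.inv_mul, one_apply_eq_self]
    have h2 := ContinuousLinearMap.le_of_opNorm_le _ hnorm (T x)
    rw [← h1] at h2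
    calc γ / 2 * ‖x‖ ≤ γ / 2 * (2 / γ * ‖T x‖) := by gcongr
      _ = ‖T x‖ := by field_simp
  have h3 : T x = B x - (γ / 2) • x := by simp [T, Algebra.algebraMap_eq_smul_one]
  have h4 : ‖T x‖ ^ 2 = ‖B x‖ ^ 2 - γ * ⟪B x, x⟫ + (γ / 2 * ‖x‖) ^ 2 := by
    rw [h3, norm_sub_sq_real, inner_smul_right, norm_smul, Real.norm_of_nonneg (by positivity)]
    ring
  have h5 : (γ / 2 * ‖x‖) ^ 2 ≤ ‖T x‖ ^ 2 := by gcongr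
  linarith

end SelfAdjoint

/-- A symmetric map on a subspace is bounded by the bound on its quadratic form. -/
theorem norm_le_of_abs_inner_le {V : Type*} [NormedAddCommGroup V] [InnerProductSpace ℝ V]
    {S : V →ₗ[ℝ] V} (hS : S.IsSymmetric) {R : Submodule ℝ V}
    (hR : ∀ x ∈ R, S x ∈ R) {ρ : ℝ} (h : ∀ x ∈ R, |⟪S x, x⟫| ≤ ρ * ‖x‖ ^ 2) {x : V} (hx : x ∈ R) :
    ‖S x‖ ≤ ρ * ‖x‖ := by
  have key : ∀ y ∈ R, 2 * ⟪S x, y⟫ ≤ ρ * (‖x‖ ^ 2 + ‖y‖ ^ 2) := by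
    intro y hy
    have h1 := (abs_le.1 (h _ (R.add_mem hx hy))).2
    have h2 := (abs_le.1 (h _ (R.sub_mem hx hy))).1
    have hsym : ⟪S y, x⟫ = ⟪S x, y⟫ := by rw [hS y x, real_inner_comm]
    rw [map_add, norm_add_sq_real, inner_add_left, inner_add_right, inner_add_right, hsym] at h1
    rw [map_sub, norm_sub_sq_real, inner_sub_left, inner_sub_right, inner_sub_right, hsym] at h2
    linarith
  by_cases hx0 : ‖x‖ = 0
  · simp [norm_eq_zero.1 hx0]
  by_cases hs0 : ‖S x‖ = 0
  · have := (abs_nonneg _).trans (h x hx)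
    have hρ : 0 ≤ ρ := nonneg_of_mul_nonneg_left this (by positivity)
    rw [hs0]
    positivity
  -- The test vector is parallel to `S x` and rescaled to length `‖x‖`, which balances the two
  -- squares in `key`.
  have h1 := key ((‖x‖ / ‖S x‖) • S x) (R.smul_mem _ (hR x hx))
  rw [inner_smul_right, real_inner_self_eq_norm_sq, norm_smul, Real.norm_of_nonneg (by positivity),
    div_mul_cancel₀ _ hs0] at h1
  have hxp : 0 < ‖x‖ := by positivity
  have h2 : 2 * (‖x‖ * ‖S x‖) ≤ 2 * (ρ * ‖x‖ * ‖x‖) := by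
    calc 2 * (‖x‖ * ‖S x‖) = 2 * (‖x‖ / ‖S x‖ * ‖S x‖ ^ 2) := by field_simp
      _ ≤ _ := h1
      _ = _ := by ring
  nlinarith

/-! ### The linearized iteration and its residual propagator. -/

section LinearizedIteration

variable {V : Type*} [NormedAddCommGroup V] [InnerProductSpace ℝ V] [CompleteSpace V]

open ContinuousLinearMap

/-- With `B = A†A`, the space `(ker A)ᗮ = (ker B)ᗮ` is the closure of the range of `B`. On vectors
`B y` the bound follows from `‖B y‖² = ⟪A B y, A y⟫` and the gap, and it is a closed condition. -/
theorem gap_mul_norm_le_of_mem_ker_orthogonal {A : V →L[ℝ] V} {γ : ℝ} (hγ : 0 < γ)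
    (hA : ∀ x, γ * ‖A x‖ ^ 2 ≤ ‖adjoint A (A x)‖ ^ 2) {x : V} (hx : x ∈ A.kerᗮ) :
    Real.sqrt γ * ‖x‖ ≤ ‖A x‖ := by
  set B : V →L[ℝ] V := adjoint A ∘L A with hB
  have hBsa : adjoint B = B := by simp [hB, adjoint_comp]
  have hker : B.ker = A.ker := by
    ext y
    simp only [LinearMap.mem_ker, coe_coe, hB, comp_apply]
    refine ⟨fun h => ?_, fun h => by simp [h]⟩
    have : ⟪A y, A y⟫ = 0 := by rw [← adjoint_inner_left, h, inner_zero_left]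
    exact inner_self_eq_zero.1 this
  rw [← hker, orthogonal_ker, hBsa, ← SetLike.mem_coe, Submodule.topologicalClosure_coe] at hx
  refine closure_minimal (t := {x | Real.sqrt γ * ‖x‖ ≤ ‖A x‖}) ?_
    (isClosed_le (by fun_prop) (by fun_prop)) hx
  rintro _ ⟨y, rfl⟩
  simp only [Set.mem_ofPred_eq, coe_coe]
  have h1 : Real.sqrt γ * ‖A y‖ ≤ ‖B y‖ := by
    apply le_of_sq_le_sq _ (norm_nonneg _)
    rw [mul_pow, Real.sq_sqrt hγ.le]
    exact hA y
  have h2 : ‖B y‖ ^ 2 ≤ ‖A (B y)‖ * ‖A y‖ := by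
    rw [← real_inner_self_eq_norm_sq]
    calc ⟪B y, B y⟫ = ⟪A (B y), A y⟫ := by
          nth_rewrite 2 [hB]
          rw [comp_apply, adjoint_inner_right]
      _ ≤ _ := real_inner_le_norm _ _
  rcases (norm_nonneg (B y)).eq_or_lt with h0 | h0
  · rw [← h0]
    simp
  have hs : 0 < Real.sqrt γ := Real.sqrt_pos.2 hγ
  have h3 : Real.sqrt γ * ‖B y‖ * ‖B y‖ ≤ ‖A (B y)‖ * ‖B y‖ :=
    calc Real.sqrt γ * ‖B y‖ * ‖B y‖ = Real.sqrt γ * ‖B y‖ ^ 2 := by ring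
      _ ≤ Real.sqrt γ * (‖A (B y)‖ * ‖A y‖) := by gcongr
      _ = ‖A (B y)‖ * (Real.sqrt γ * ‖A y‖) := by ring
      _ ≤ _ := by gcongr
  exact le_of_mul_le_mul_right h3 h0

/-- The coefficient of the mode elimination along `g`, for the step `τ` and the operator `A`. -/
noncomputable def modeCoeff (τ : ℝ) (A : V →L[ℝ] V) (g : V) : ℝ :=
  1 / ‖g‖ ^ 2 - 1 / (‖A g‖ ^ 2 * τ)

/-- The preconditioner `y ↦ A† y - α ⟪A g, y⟫ g` applied to the residual. -/
noncomputable def modePrecond (τ : ℝ) (A : V →L[ℝ] V) (g : V) : V →L[ℝ] V :=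
  adjoint A - modeCoeff τ A g • (innerSL ℝ (A g)).smulRight g

theorem modePrecond_apply (τ : ℝ) (A : V →L[ℝ] V) (g y : V) :
    modePrecond τ A g y = adjoint A y - (modeCoeff τ A g * ⟪A g, y⟫) • g := by
  simp [modePrecond, mul_smul]

theorem tendsto_clm_apply {ι E F : Type*} [NormedAddCommGroup E] [NormedSpace ℝ E]
    [NormedAddCommGroup F] [NormedSpace ℝ F] {l : Filter ι} {A : ι → E →L[ℝ] F} {g : ι → E}
    {A₀ : E →L[ℝ] F} {g₀ : E} (hA : Tendsto A l (𝓝 A₀)) (hg : Tendsto g l (𝓝 g₀)) :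
    Tendsto (fun i => A i (g i)) l (𝓝 (A₀ g₀)) :=
  (isBoundedBilinearMap_apply.continuous.tendsto (A₀, g₀)).comp (hA.prodMk_nhds hg)

theorem tendsto_modePrecond {ι : Type*} {l : Filter ι} {τ : ℝ} (hτ : τ ≠ 0) {A : ι → V →L[ℝ] V}
    {g : ι → V} {A₀ : V →L[ℝ] V} {g₀ : V} (hA : Tendsto A l (𝓝 A₀)) (hg : Tendsto g l (𝓝 g₀))
    (hAg : A₀ g₀ ≠ 0) :
    Tendsto (fun i => modePrecond τ (A i) (g i)) l (𝓝 (modePrecond τ A₀ g₀)) := by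
  have hg0 : g₀ ≠ 0 := fun h => hAg (by simp [h])
  have h1 : Tendsto (fun i => A i (g i)) l (𝓝 (A₀ g₀)) := tendsto_clm_apply hA hg
  have h2 : Tendsto (fun i => modeCoeff τ (A i) (g i)) l (𝓝 (modeCoeff τ A₀ g₀)) :=
    (tendsto_const_nhds.div (hg.norm.pow 2) (by simpa using hg0)).sub
      (tendsto_const_nhds.div ((h1.norm.pow 2).mul tendsto_const_nhds) (by simp [hAg, hτ]))
  have h3 : Tendsto (fun i => smulRightL ℝ V V (innerSL ℝ (A i (g i))) (g i)) l
      (𝓝 (smulRightL ℝ V V (innerSL ℝ (A₀ g₀)) g₀)) :=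
    tendsto_clm_apply (((smulRightL ℝ V V).continuous.tendsto _).comp
      (((innerSL ℝ).continuous.tendsto _).comp h1)) hg
  exact ((adjoint.continuous.tendsto _).comp hA).sub (h2.smul h3)

/-- The linearized propagator of the residual. -/
noncomputable def residualPropagator (τ : ℝ) (A : V →L[ℝ] V) (g : V) : V →L[ℝ] V :=
  ContinuousLinearMap.id ℝ V - τ • (A ∘L modePrecond τ A g)

theorem residualPropagator_apply (τ : ℝ) (A : V →L[ℝ] V) (g y : V) :
    residualPropagator τ A g y = y - τ • A (modePrecond τ A g y) := by
  simp [residualPropagator]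

theorem inner_residualPropagator (τ : ℝ) (A : V →L[ℝ] V) (g x y : V) :
    ⟪residualPropagator τ A g x, y⟫ =
      ⟪x, y⟫ - τ * (⟪adjoint A x, adjoint A y⟫ - modeCoeff τ A g * (⟪A g, x⟫ * ⟪A g, y⟫)) := by
  rw [residualPropagator_apply, modePrecond_apply, inner_sub_left, real_inner_smul_left, map_sub,
    map_smul, inner_sub_left, real_inner_smul_left, adjoint_inner_right]
  ring

/-- Composing with `A` on the left turns the rank-one term of the preconditioner into a multiple of
`⟪A g, ·⟫ A g`. -/
theorem residualPropagator_isSymmetric (τ : ℝ) (A : V →L[ℝ] V) (g : V) :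
    (residualPropagator τ A g : V →ₗ[ℝ] V).IsSymmetric := by
  intro x y
  simp only [coe_coe]
  rw [← real_inner_comm x, inner_residualPropagator, inner_residualPropagator, real_inner_comm x y,
    real_inner_comm (adjoint A x)]
  ring

/-- Let `r` be the squared length of the component of `A† y` along `g`. The mode elimination
replaces `‖A† y‖²` in the quadratic form by `(‖A† y‖² - r) + θ r`, that is, it weights this
component by `θ`. Bounds on this quantity from both sides suffice by symmetry: `h1` serves `θ ≤ 1`,
`h2` serves `θ ≥ 1`, and the gap gives the lower bound. -/
theorem exists_norm_residualPropagator_le {A : V →L[ℝ] V} {g : V} {τ γ l : ℝ} (hAg : A g ≠ 0)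
    (hγ : 0 < γ) (hA : ∀ x, γ * ‖A x‖ ^ 2 ≤ ‖adjoint A (A x)‖ ^ 2)
    (hl : ∀ x, ‖A x‖ ^ 2 ≤ l * ‖x‖ ^ 2) (hτ : 0 < τ) (h1 : τ * l < 2)
    (h2 : τ * (l - ‖A g‖ ^ 2 / ‖g‖ ^ 2) < 1) :
    ∃ ρ, 0 ≤ ρ ∧ ρ < 1 ∧ ∀ x, ‖residualPropagator τ A g (A x)‖ ≤ ρ * ‖A x‖ := by
  have hg : g ≠ 0 := fun h => hAg (by simp [h])
  have hgp : 0 < ‖g‖ ^ 2 := by positivity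
  have hAgp : 0 < ‖A g‖ ^ 2 := by positivity
  set θ := ‖g‖ ^ 2 / (‖A g‖ ^ 2 * τ) with hθ
  have hθp : 0 < θ := by positivity
  have hlp : 0 ≤ l := by
    have := hl g
    by_contra hneg
    nlinarith
  have hadj : ∀ y, ‖adjoint A y‖ ^ 2 ≤ l * ‖y‖ ^ 2 := by
    intro y
    have e1 : ‖adjoint A y‖ ^ 2 ≤ ‖A (adjoint A y)‖ * ‖y‖ := by
      rw [← real_inner_self_eq_norm_sq, adjoint_inner_right]
      exact real_inner_le_norm _ _
    have e2 : (‖adjoint A y‖ ^ 2) ^ 2 ≤ l * ‖adjoint A y‖ ^ 2 * ‖y‖ ^ 2 :=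
      calc (‖adjoint A y‖ ^ 2) ^ 2 ≤ (‖A (adjoint A y)‖ * ‖y‖) ^ 2 := by gcongr
        _ = ‖A (adjoint A y)‖ ^ 2 * ‖y‖ ^ 2 := by ring
        _ ≤ _ := by
          gcongr
          exact hl _
    by_cases h0 : ‖adjoint A y‖ ^ 2 = 0
    · rw [h0]; positivity
    · have hp : 0 < ‖adjoint A y‖ ^ 2 := lt_of_le_of_ne (by positivity) (Ne.symm h0)
      nlinarith
  have hquad : ∀ y, ⟪residualPropagator τ A g y, y⟫ =
      ‖y‖ ^ 2 - τ * ((‖adjoint A y‖ ^ 2 - ⟪A g, y⟫ ^ 2 / ‖g‖ ^ 2)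
        + θ * (⟪A g, y⟫ ^ 2 / ‖g‖ ^ 2)) := by
    intro y
    rw [inner_residualPropagator, real_inner_self_eq_norm_sq, real_inner_self_eq_norm_sq,
      modeCoeff, hθ]
    field_simp
    ring
  -- Cauchy–Schwarz for `⟪g, A† y⟫`: the component along `g` is no longer than the vector.
  have hX : ∀ y, ⟪A g, y⟫ ^ 2 / ‖g‖ ^ 2 ≤ ‖adjoint A y‖ ^ 2 := by
    intro y
    rw [div_le_iff₀ hgp, ← adjoint_inner_right, ← mul_pow, mul_comm, ← sq_abs]
    gcongr
    exact abs_real_inner_le_norm _ _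
  have hY : ∀ y, ⟪A g, y⟫ ^ 2 ≤ ‖A g‖ ^ 2 * ‖y‖ ^ 2 := by
    intro y
    rw [← mul_pow, ← sq_abs]
    gcongr
    exact abs_real_inner_le_norm _ _
  set m := min 1 θ with hm
  have hmp : 0 < m := lt_min one_pos hθp
  have hm1 : m ≤ 1 := min_le_left _ _
  have hmθ : m ≤ θ := min_le_right _ _
  set ρ := max 0 (max (1 - τ * (m * γ))
    (max (τ * l - 1) (τ * (l - ‖A g‖ ^ 2 / ‖g‖ ^ 2)))) with hρ
  have hρ0 : 0 ≤ ρ := le_max_left _ _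
  have hρ1 : 1 - τ * (m * γ) ≤ ρ := (le_max_left _ _).trans (le_max_right _ _)
  have hρ2 : τ * l - 1 ≤ ρ :=
    (le_max_left _ _).trans ((le_max_right _ _).trans (le_max_right _ _))
  have hρ3 : τ * (l - ‖A g‖ ^ 2 / ‖g‖ ^ 2) ≤ ρ :=
    (le_max_right _ _).trans ((le_max_right _ _).trans (le_max_right _ _))
  have hρlt : ρ < 1 := by
    have : 0 < τ * (m * γ) := by positivity
    refine max_lt one_pos (max_lt (by linarith) (max_lt (by linarith) h2))
  refine ⟨ρ, hρ0, hρlt, fun x => ?_⟩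
  refine norm_le_of_abs_inner_le (S := (residualPropagator τ A g : V →ₗ[ℝ] V))
    (residualPropagator_isSymmetric τ A g) (R := A.range) ?_ ?_ ⟨x, rfl⟩
  · rintro _ ⟨z, rfl⟩
    refine ⟨z - τ • modePrecond τ A g (A z), ?_⟩
    simp [residualPropagator_apply]
  · rintro _ ⟨z, rfl⟩
    simp only [coe_coe]
    rw [hquad]
    have c1 := hX (A z)
    have c2 := hA z
    have c3 := hadj (A z)
    have c4 := hY (A z)
    set b := ‖A z‖ ^ 2
    set p := ‖adjoint A (A z)‖ ^ 2
    set r := ⟪A g, A z⟫ ^ 2 / ‖g‖ ^ 2 with hr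
    have hb : 0 ≤ b := by positivity
    have hr0 : 0 ≤ r := by positivity
    rw [abs_le]
    constructor
    · suffices h : τ * ((p - r) + θ * r) ≤ (1 + ρ) * b by linarith
      rcases le_total θ 1 with hle | hle
      · calc τ * ((p - r) + θ * r) ≤ τ * p := by
              gcongr
              nlinarith
          _ ≤ τ * (l * b) := by gcongr
          _ = τ * l * b := by ring
          _ ≤ _ := by
            gcongr
            linarith
      · have e1 : r ≤ ‖A g‖ ^ 2 / ‖g‖ ^ 2 * b := by
          rw [hr, div_mul_eq_mul_div]
          gcongr
        -- By the choice of `α`, the amplified part contributes exactly `1`, leaving `τ (l - ‖A g‖²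
        -- / ‖g‖²) < 1` for the rest; this is the source of the second step bound.
        have e2 : τ * θ * (‖A g‖ ^ 2 / ‖g‖ ^ 2) = 1 := by
          rw [hθ]
          field_simp
        calc τ * ((p - r) + θ * r) = τ * p + τ * ((θ - 1) * r) := by ring
          _ ≤ τ * (l * b) + τ * ((θ - 1) * (‖A g‖ ^ 2 / ‖g‖ ^ 2 * b)) := by
            gcongr
          _ = (τ * θ * (‖A g‖ ^ 2 / ‖g‖ ^ 2) + τ * (l - ‖A g‖ ^ 2 / ‖g‖ ^ 2)) * b := by ring
          _ ≤ _ := by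
            rw [e2]
            gcongr
    · suffices h : (1 - ρ) * b ≤ τ * ((p - r) + θ * r) by linarith
      calc (1 - ρ) * b ≤ τ * (m * γ) * b := by
            gcongr
            linarith
        _ = τ * (m * (γ * b)) := by ring
        _ ≤ τ * (m * p) := by gcongr
        _ = τ * (m * (p - r) + m * r) := by ring
        _ ≤ τ * ((p - r) + θ * r) := by
          gcongr
          exact mul_le_of_le_one_left (by linarith) hm1

/-- Under `hx` the vector `A x` is fixed by the propagator, which is a strict contraction on the
range of `A`. -/
theorem eq_zero_of_apply_modePrecond_eq_zero {A : V →L[ℝ] V} {g : V} {τ ρ : ℝ} (hρ : ρ < 1)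
    (h : ∀ x, ‖residualPropagator τ A g (A x)‖ ≤ ρ * ‖A x‖) {x : V}
    (hx : A (modePrecond τ A g (A x)) = 0) : A x = 0 := by
  have h1 := h x
  rw [residualPropagator_apply, hx, smul_zero, sub_zero] at h1
  have : ‖A x‖ ≤ 0 := by nlinarith [norm_nonneg (A x)]
  exact norm_le_zero_iff.1 this

/-- The complex eigenvalues of `-Q A`, where `Q` is the preconditioner. -/
theorem eigenvalue_of_norm_residualPropagator_le {A : V →L[ℝ] V} {g : V} {τ ρ : ℝ} (hτ : 0 < τ)
    (hρ : ρ < 1) (h : ∀ x, ‖residualPropagator τ A g (A x)‖ ≤ ρ * ‖A x‖) {T : V →ₗ[ℝ] V}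
    (hT : ∀ x, T x = -modePrecond τ A g (A x)) {z : ℂ}
    (hz : AccelerationOperator.IsComplexEigenvalue T z) :
    z.im = 0 ∧ z.re ≤ 0 ∧ (z ≠ 0 → ‖1 + z * (τ : ℂ)‖ < 1) := by
  obtain ⟨x, y, hxy, hx, hy⟩ := hz
  -- This intertwining lets `A` send eigenfunctions of `T` to eigenvectors of a symmetric
  -- contraction, unless `A` kills them; in that case `T` kills them too and `z = 0`.
  have hS : ∀ v, residualPropagator τ A g (A v) = A v + τ • A (T v) := by
    intro v
    rw [hT, residualPropagator_apply, map_neg, smul_neg, sub_eq_add_neg]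
  by_cases hker : A x = 0 ∧ A y = 0
  · have hTx : T x = 0 := by simp [hT, hker.1]
    have hTy : T y = 0 := by simp [hT, hker.2]
    rw [hTx] at hx
    rw [hTy] at hy
    have e1 : (z.re ^ 2 + z.im ^ 2) • x = 0 := by
      have : (z.re ^ 2 + z.im ^ 2) • x
          = z.re • (z.re • x - z.im • y) + z.im • (z.im • x + z.re • y) := by module
      rw [this, ← hx, ← hy]
      simp
    have e2 : (z.re ^ 2 + z.im ^ 2) • y = 0 := by
      have : (z.re ^ 2 + z.im ^ 2) • y
          = z.re • (z.im • x + z.re • y) - z.im • (z.re • x - z.im • y) := by module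
      rw [this, ← hx, ← hy]
      simp
    have e3 : z.re ^ 2 + z.im ^ 2 = 0 := by
      rcases hxy with h0 | h0
      · exact (smul_eq_zero.1 e1).resolve_right h0
      · exact (smul_eq_zero.1 e2).resolve_right h0
    have hre : z.re = 0 := by nlinarith [sq_nonneg z.re, sq_nonneg z.im]
    have him : z.im = 0 := by nlinarith [sq_nonneg z.re, sq_nonneg z.im]
    exact ⟨him, hre.le, fun hne => absurd (Complex.ext hre him) hne⟩
  · have hSx := hS x
    have hSy := hS y
    rw [hx, map_sub, map_smul, map_smul] at hSx
    rw [hy, map_add, map_smul, map_smul] at hSy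
    have hpos : 0 < ‖A x‖ ^ 2 + ‖A y‖ ^ 2 := by
      rcases not_and_or.1 hker with h0 | h0
      · have := norm_pos_iff.2 h0
        positivity
      · have := norm_pos_iff.2 h0
        positivity
    have him : z.im = 0 := by
      have hsym : ⟪residualPropagator τ A g (A x), A y⟫ = ⟪A x, residualPropagator τ A g (A y)⟫ :=
        residualPropagator_isSymmetric τ A g (A x) (A y)
      rw [hSx, hSy] at hsym
      simp only [inner_add_left, inner_add_right, inner_sub_left, real_inner_smul_left,
        real_inner_smul_right, real_inner_self_eq_norm_sq] at hsym
      have : τ * z.im * (‖A x‖ ^ 2 + ‖A y‖ ^ 2) = 0 := by linarith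
      simpa [hτ.ne', hpos.ne'] using this
    have key : ∀ v, A v ≠ 0 → residualPropagator τ A g (A v) = (1 + τ * z.re) • A v →
        |1 + τ * z.re| < 1 := by
      intro v hv hv'
      have h1 := h v
      rw [hv', norm_smul, Real.norm_eq_abs] at h1
      exact (le_of_mul_le_mul_right h1 (norm_pos_iff.2 hv)).trans_lt hρ
    have hlt : |1 + τ * z.re| < 1 := by
      rcases not_and_or.1 hker with h0 | h0
      · refine key x h0 ?_
        rw [hSx, him]
        module
      · refine key y h0 ?_
        rw [hSy, him]
        module
    refine ⟨him, ?_, fun _ => ?_⟩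
    · have := (abs_lt.1 hlt).2
      by_contra hc
      nlinarith
    · have : 1 + z * (τ : ℂ) = ((1 + τ * z.re : ℝ) : ℂ) := by
        apply Complex.ext <;> simp [him, mul_comm]
      rw [this, Complex.norm_real]
      exact hlt

end LinearizedIteration

/-! ### Abstract convergence and a retraction onto the family. -/

/-- Convergence of an iteration whose increments are controlled by a geometrically decaying
residual near a point. -/
theorem exists_tendsto_of_residual_contraction {V : Type*} [NormedAddCommGroup V] [CompleteSpace V]
    {f : V → ℝ} (hf : ∀ x, 0 ≤ f x) {u : V} {r C q : ℝ} (hC : 0 ≤ C) (hq0 : 0 ≤ q) (hq1 : q < 1)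
    {w : ℕ → V}
    (hstep : ∀ n, ‖w n - u‖ < r → ‖w (n + 1) - w n‖ ≤ C * f (w n) ∧ f (w (n + 1)) ≤ q * f (w n))
    (h0 : ‖w 0 - u‖ + C * f (w 0) / (1 - q) < r) :
    (∀ n, ‖w n - u‖ < r) ∧ Tendsto (fun n => f (w n)) atTop (𝓝 0) ∧
      ∃ l, ‖l - u‖ < r ∧ Tendsto w atTop (𝓝 l) := by
  have hq : 0 < 1 - q := sub_pos.2 hq1
  set D := C * f (w 0) with hD
  have hD0 : 0 ≤ D := mul_nonneg hC (hf _)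
  -- Decay and distance must be proved together: the geometric partial sum keeps the iterate in the
  -- ball where `hstep` applies.
  have hind : ∀ n, f (w n) ≤ q ^ n * f (w 0) ∧
      ‖w n - u‖ ≤ ‖w 0 - u‖ + D * (1 - q ^ n) / (1 - q) := by
    intro n
    induction n with
    | zero => simp
    | succ n ih =>
      have hlt : ‖w n - u‖ < r := by
        refine ih.2.trans_lt (lt_of_le_of_lt ?_ h0)
        gcongr
        exact mul_le_of_le_one_right hD0 (by linarith [pow_nonneg hq0 n])
      obtain ⟨a1, a2⟩ := hstep n hlt
      constructor
      · calc f (w (n + 1)) ≤ q * f (w n) := a2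
          _ ≤ q * (q ^ n * f (w 0)) := by
            gcongr
            exact ih.1
          _ = _ := by ring
      · calc ‖w (n + 1) - u‖ = ‖(w (n + 1) - w n) + (w n - u)‖ := by rw [sub_add_sub_cancel]
          _ ≤ ‖w (n + 1) - w n‖ + ‖w n - u‖ := norm_add_le _ _
          _ ≤ C * (q ^ n * f (w 0)) + (‖w 0 - u‖ + D * (1 - q ^ n) / (1 - q)) := by
            gcongr
            · exact a1.trans (by gcongr; exact ih.1)
            · exact ih.2
          _ = _ := by
            rw [hD]
            field_simp
            ring
  have hbound : ∀ n, ‖w n - u‖ ≤ ‖w 0 - u‖ + D / (1 - q) := by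
    intro n
    refine (hind n).2.trans ?_
    gcongr
    exact mul_le_of_le_one_right hD0 (by linarith [pow_nonneg hq0 n])
  have hlt : ∀ n, ‖w n - u‖ < r := fun n => (hbound n).trans_lt h0
  refine ⟨hlt, ?_, ?_⟩
  · refine squeeze_zero (fun n => hf _) (fun n => (hind n).1) ?_
    simpa using (tendsto_pow_atTop_nhds_zero_of_lt_one hq0 hq1).mul_const (f (w 0))
  · have hcau : CauchySeq w := by
      refine cauchySeq_of_le_geometric q D hq1 fun n => ?_
      rw [dist_comm, dist_eq_norm]
      calc ‖w (n + 1) - w n‖ ≤ C * f (w n) := (hstep n (hlt n)).1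
        _ ≤ C * (q ^ n * f (w 0)) := by
          gcongr
          exact (hind n).1
        _ = _ := by
          rw [hD]
          ring
    obtain ⟨l, hl⟩ := cauchySeq_tendsto_of_complete hcau
    refine ⟨l, lt_of_le_of_lt ?_ h0, hl⟩
    exact le_of_tendsto' (hl.sub_const u).norm hbound

/-- A parametrized family has a local retraction: near a base point, every point differs from a
member of the family by a vector orthogonal to the tangent space at the base point. -/
theorem HasStrictFDerivAt.exists_orthogonal_parameter {E V : Type*} [NormedAddCommGroup E]
    [NormedSpace ℝ E] [FiniteDimensional ℝ E] [NormedAddCommGroup V] [InnerProductSpace ℝ V]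
    [CompleteSpace V] {U : E → V} {D : E →L[ℝ] V} {c₀ : E} (hU : HasStrictFDerivAt U D c₀) :
    ∃ σ : V → E, Tendsto σ (𝓝 (U c₀)) (𝓝 c₀) ∧ ∀ᶠ w in 𝓝 (U c₀), w - U (σ w) ∈ D.rangeᗮ := by
  set K := D.range with hK
  -- `D` may fail to be injective, so a right inverse `R` on its range selects a slice of parameters
  -- on which the projected family has derivative the identity. The inverse function theorem there
  -- solves `P (U c) = P w`.
  have : FiniteDimensional ℝ K := inferInstanceAs (FiniteDimensional ℝ D.toLinearMap.range)
  obtain ⟨R₀, hR₀⟩ := D.toLinearMap.rangeRestrict.exists_rightInverse_of_surjective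
    D.toLinearMap.range_rangeRestrict
  set R : K →L[ℝ] E := R₀.toContinuousLinearMap with hR
  have hDR : ∀ k : K, D (R k) = k := by
    intro k
    have := congrArg Subtype.val (LinearMap.congr_fun hR₀ k)
    change D (R₀ k) = k
    simpa using this
  set P : V →L[ℝ] K := K.orthogonalProjectionOnto with hP
  set k₀ : K := P (U c₀) with hk₀
  set ψ : K → E := fun k => c₀ + R (k - k₀) with hψ
  have hψ0 : ψ k₀ = c₀ := by simp [hψ]
  have hψd : HasStrictFDerivAt ψ R k₀ := by
    have h1 : HasStrictFDerivAt (fun k : K => k - k₀) (ContinuousLinearMap.id ℝ K) k₀ :=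
      (hasStrictFDerivAt_id k₀).sub_const k₀
    exact (R.hasStrictFDerivAt.comp k₀ h1).const_add c₀
  have hh : HasStrictFDerivAt (fun k => P (U (ψ k)))
      ((ContinuousLinearEquiv.refl ℝ K : K ≃L[ℝ] K) : K →L[ℝ] K) k₀ := by
    have h1 : HasStrictFDerivAt U D (ψ k₀) := by rwa [hψ0]
    have h2 := P.hasStrictFDerivAt.comp k₀ (h1.comp k₀ hψd)
    convert! h2 using 1
    ext k
    simp only [ContinuousLinearEquiv.coe_refl, ContinuousLinearMap.coe_id', id_eq,
      ContinuousLinearMap.comp_apply, hDR, hP,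
      Submodule.orthogonalProjectionOnto_mem_subspace_eq_self]
  have hPt : Tendsto P (𝓝 (U c₀)) (𝓝 k₀) := P.continuous.continuousAt
  have hval : P (U (ψ k₀)) = k₀ := by rw [hψ0]
  have hinv := hh.localInverse_tendsto
  have hright := hh.eventually_right_inverse
  rw [hval] at hinv hright
  set θ := hh.localInverse with hθ
  refine ⟨fun w => ψ (θ (P w)), ?_, ?_⟩
  · have : Tendsto ψ (𝓝 k₀) (𝓝 c₀) := by
      have := hψd.continuousAt.tendsto
      rwa [hψ0] at this
    exact this.comp (hinv.comp hPt)
  · filter_upwards [hPt.eventually hright] with w hw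
    rw [← Submodule.orthogonalProjectionOnto_eq_zero_iff, map_sub, sub_eq_zero]
    exact hw.symm

/-! ### Nonlinear contraction of the residual and local convergence. -/

section Iteration

open Asymptotics

variable {V : Type*} [NormedAddCommGroup V] [InnerProductSpace ℝ V] [CompleteSpace V]

/-- One step of the iteration contracts the residual, uniformly for preconditioners close to the
limiting one. -/
theorem eventually_norm_residual_le {F : V → V} {A : V →L[ℝ] V} {u g : V}
    (hF : HasStrictFDerivAt F A u) (hFu : F u = 0) {p : V → V} (hp : Tendsto p (𝓝 u) (𝓝 u))
    (hFp : ∀ᶠ w in 𝓝 u, F (p w) = 0) {κ : ℝ} (hκ : 0 < κ)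
    (hlow : ∀ᶠ w in 𝓝 u, κ * ‖w - p w‖ ≤ ‖A (w - p w)‖) {τ ρ : ℝ} (hρ0 : 0 ≤ ρ) (hρ : ρ < 1)
    (h : ∀ x, ‖residualPropagator τ A g (A x)‖ ≤ ρ * ‖A x‖) :
    ∀ᶠ x : V × (V →L[ℝ] V) in 𝓝 (u, modePrecond τ A g),
      ‖F (x.1 - τ • x.2 (F x.1))‖ ≤ (1 + ρ) / 2 * ‖F x.1‖ := by
  set N₀ := modePrecond τ A g with hN₀
  set l : Filter (V × (V →L[ℝ] V)) := 𝓝 (u, N₀) with hl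
  have t1 : Tendsto (fun x : V × (V →L[ℝ] V) => x.1) l (𝓝 u) := continuousAt_fst
  have t2 : Tendsto (fun x : V × (V →L[ℝ] V) => x.2) l (𝓝 N₀) := continuousAt_snd
  have hF0 : Tendsto (fun x : V × (V →L[ℝ] V) => F x.1) l (𝓝 0) := by
    have := hF.continuousAt.tendsto.comp t1
    rwa [hFu] at this
  set a : V × (V →L[ℝ] V) → V := fun x => A (x.1 - p x.1) with ha
  -- `F` vanishes at `p w`, and coercivity bounds `w - p w` by `a`. So the residual is, to first
  -- order, the vector `a` in the range of `A`, the only place where the propagator is known to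
  -- contract.
  have b1 : (fun x : V × (V →L[ℝ] V) => F x.1 - a x) =o[l] a := by
    have c1 := hF.isLittleO.comp_tendsto (t1.prodMk_nhds (hp.comp t1))
    have c2 : (fun x : V × (V →L[ℝ] V) => x.1 - p x.1) =O[l] a := by
      refine IsBigO.of_bound κ⁻¹ ?_
      filter_upwards [t1.eventually hlow] with x hx
      rw [inv_mul_eq_div, le_div_iff₀ hκ, mul_comm]
      exact hx
    refine (c1.congr' ?_ (Eventually.of_forall fun _ => rfl)).trans_isBigO c2
    filter_upwards [t1.eventually hFp] with x hx
    simp [ha, hx]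
  have b2 : (fun x : V × (V →L[ℝ] V) => F x.1 - a x) =o[l] fun x => F x.1 := by
    refine b1.trans_isBigO ?_
    simpa using b1.right_isBigO_add
  have b3 : (fun x : V × (V →L[ℝ] V) => -(τ • x.2 (F x.1))) =O[l] fun x => F x.1 := by
    refine IsBigO.of_bound (|τ| * (‖N₀‖ + 1)) ?_
    filter_upwards [t2.norm.eventually_lt_const (lt_add_one _)] with x hx
    rw [norm_neg, norm_smul, Real.norm_eq_abs, mul_assoc]
    gcongr
    exact x.2.le_of_opNorm_le hx.le _
  have b4 : Tendsto (fun x : V × (V →L[ℝ] V) => x.1 - τ • x.2 (F x.1)) l (𝓝 u) := by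
    have := t1.add (b3.trans_tendsto hF0)
    simpa [sub_eq_add_neg] using this
  have b5 : (fun x : V × (V →L[ℝ] V) =>
      F (x.1 - τ • x.2 (F x.1)) - F x.1 + τ • A (x.2 (F x.1))) =o[l] fun x => F x.1 := by
    have c1 := hF.isLittleO.comp_tendsto (b4.prodMk_nhds t1)
    have c2 : (fun x : V × (V →L[ℝ] V) => x.1 - τ • x.2 (F x.1) - x.1) =O[l] fun x => F x.1 := by
      refine b3.congr_left fun x => ?_
      abel
    refine (c1.trans_isBigO c2).congr_left fun x => ?_
    simp
  have b6 : (fun x : V × (V →L[ℝ] V) => τ • A ((x.2 - N₀) (F x.1))) =o[l] fun x => F x.1 := by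
    have c1 : (fun x : V × (V →L[ℝ] V) => (x.2 - N₀) (F x.1)) =o[l] fun x => F x.1 := by
      have : Tendsto (fun x : V × (V →L[ℝ] V) => ‖x.2 - N₀‖) l (𝓝 0) := by
        simpa using (t2.sub_const N₀).norm
      refine IsLittleO.of_bound fun c hc => ?_
      filter_upwards [this.eventually_lt_const hc] with x hx
      exact (x.2 - N₀).le_of_opNorm_le hx.le _
    exact ((τ • A).isBigO_comp _ _).trans_isLittleO c1
  have b7 : (fun x : V × (V →L[ℝ] V) => residualPropagator τ A g (F x.1 - a x)) =o[l]
      fun x => F x.1 :=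
    ((residualPropagator τ A g).isBigO_comp _ _).trans_isLittleO b2
  have b8 := (b5.sub b6).add b7
  -- Two errors of relative size `(1 - ρ) / 4`, one of them multiplied by `ρ ≤ 1`, raise the factor
  -- `ρ` to at most `(1 + ρ) / 2`.
  have hε : 0 < (1 - ρ) / 4 := by linarith
  filter_upwards [b8.bound hε, b2.bound hε] with x hx hx'
  have e1 : F (x.1 - τ • x.2 (F x.1)) =
      (F (x.1 - τ • x.2 (F x.1)) - F x.1 + τ • A (x.2 (F x.1)) - τ • A ((x.2 - N₀) (F x.1))
        + residualPropagator τ A g (F x.1 - a x)) + residualPropagator τ A g (a x) := by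
    rw [add_assoc, ← map_add, sub_add_cancel, residualPropagator_apply, ← hN₀,
      sub_apply, map_sub, smul_sub]
    abel
  have e2 : ‖a x‖ ≤ ‖F x.1‖ + (1 - ρ) / 4 * ‖F x.1‖ :=
    calc ‖a x‖ = ‖F x.1 - (F x.1 - a x)‖ := by rw [sub_sub_cancel]
      _ ≤ ‖F x.1‖ + ‖F x.1 - a x‖ := norm_sub_le _ _
      _ ≤ _ := by gcongr
  have hn := norm_nonneg (F x.1)
  rw [e1]
  calc _ ≤ (1 - ρ) / 4 * ‖F x.1‖ + ρ * ‖a x‖ := (norm_add_le _ _).trans (add_le_add hx (h _))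
    _ ≤ (1 - ρ) / 4 * ‖F x.1‖ + ρ * (‖F x.1‖ + (1 - ρ) / 4 * ‖F x.1‖) := by gcongr
    _ ≤ (1 - ρ) / 4 * ‖F x.1‖ + (ρ * ‖F x.1‖ + (1 - ρ) / 4 * ‖F x.1‖) := by
      have := mul_le_of_le_one_left (mul_nonneg hε.le hn) hρ.le
      linarith
    _ = _ := by ring

/-- Near a zero of `F`, with modes close to the limiting one, the step is well defined, of bounded
length relative to the residual, and contracts the residual. -/
theorem eventually_forall_modePrecond_step {F : V → V} {A : V → V →L[ℝ] V} {u g : V}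
    (hF : HasStrictFDerivAt F (A u) u) (hFu : F u = 0) (hA : ContinuousAt A u) (hg : A u g ≠ 0)
    {p : V → V} (hp : Tendsto p (𝓝 u) (𝓝 u)) (hFp : ∀ᶠ w in 𝓝 u, F (p w) = 0) {κ : ℝ}
    (hκ : 0 < κ) (hlow : ∀ᶠ w in 𝓝 u, κ * ‖w - p w‖ ≤ ‖A u (w - p w)‖) {τ ρ : ℝ} (hτ : 0 < τ)
    (hρ0 : 0 ≤ ρ) (hρ : ρ < 1) (h : ∀ x, ‖residualPropagator τ (A u) g (A u x)‖ ≤ ρ * ‖A u x‖)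
    {G : ℕ → V → V} (hG : ∃ C : ℝ, ∀ᶠ w in 𝓝 u, ∀ n, ‖G n w - g‖ ≤ C * ‖w - u‖) :
    ∀ᶠ w in 𝓝 u, ∀ n, A w (G n w) ≠ 0 ∧
      ‖modePrecond τ (A w) (G n w)‖ < ‖modePrecond τ (A u) g‖ + 1 ∧
      ‖F (w - τ • modePrecond τ (A w) (G n w) (F w))‖ ≤ (1 + ρ) / 2 * ‖F w‖ := by
  have hAu : Tendsto (fun x : V × V => A x.1) (𝓝 (u, g)) (𝓝 (A u)) :=
    hA.tendsto.comp continuousAt_fst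
  have hsnd : Tendsto (fun x : V × V => x.2) (𝓝 (u, g)) (𝓝 g) := continuousAt_snd
  -- Treating the point and the mode as independent variables gives a neighbourhood free of `n`;
  -- `hG` then puts every `(w, G n w)` in it at once.
  have hgood : ∀ᶠ x : V × V in 𝓝 (u, g), A x.1 x.2 ≠ 0 ∧
      ‖modePrecond τ (A x.1) x.2‖ < ‖modePrecond τ (A u) g‖ + 1 ∧
      ‖F (x.1 - τ • modePrecond τ (A x.1) x.2 (F x.1))‖ ≤ (1 + ρ) / 2 * ‖F x.1‖ := by
    have t1 : Tendsto (fun x : V × V => A x.1 x.2) (𝓝 (u, g)) (𝓝 (A u g)) :=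
      tendsto_clm_apply hAu hsnd
    have t2 : Tendsto (fun x : V × V => modePrecond τ (A x.1) x.2) (𝓝 (u, g))
        (𝓝 (modePrecond τ (A u) g)) :=
      tendsto_modePrecond hτ.ne' hAu hsnd hg
    have t3 : Tendsto (fun x : V × V => (x.1, modePrecond τ (A x.1) x.2)) (𝓝 (u, g))
        (𝓝 (u, modePrecond τ (A u) g)) :=
      Tendsto.prodMk_nhds continuousAt_fst t2
    filter_upwards [t1.eventually_ne hg, t2.norm.eventually_lt_const (lt_add_one _),
      t3.eventually (eventually_norm_residual_le hF hFu hp hFp hκ hlow hρ0 hρ h)] with x h1 h2 h3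
    exact ⟨h1, h2, h3⟩
  obtain ⟨C, hC⟩ := hG
  obtain ⟨η, hη, hball⟩ := Metric.eventually_nhds_iff.1 hgood
  have s1 : Tendsto (fun w => ‖w - u‖) (𝓝 u) (𝓝 0) := tendsto_norm_sub_self u
  have s2 : Tendsto (fun w => C * ‖w - u‖) (𝓝 u) (𝓝 0) := by simpa using s1.const_mul C
  filter_upwards [hC, s1.eventually_lt_const hη, s2.eventually_lt_const hη] with w h1 h2 h3 n
  refine hball (y := (w, G n w)) ?_
  rw [Prod.dist_eq, max_lt_iff, dist_eq_norm, dist_eq_norm]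
  exact ⟨h2, (h1 n).trans_lt h3⟩

/-- Local convergence of the preconditioned iteration `w ↦ w - τ Q(w) F(w)` to the family of zeros
of `F`. -/
theorem exists_forall_tendsto_zero_family {F : V → V} {A : V → V →L[ℝ] V} {u g : V}
    (hF : HasStrictFDerivAt F (A u) u) (hFc : ∀ᶠ w in 𝓝 u, ContinuousAt F w)
    (hA : ContinuousAt A u) (hg : A u g ≠ 0)
    {E : Type*} [NormedAddCommGroup E] [NormedSpace ℝ E] [FiniteDimensional ℝ E] {U : E → V}
    {D : E →L[ℝ] V} {c₀ : E} (hU : HasStrictFDerivAt U D c₀) (hu : U c₀ = u)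
    (hFU : ∀ᶠ c in 𝓝 c₀, F (U c) = 0) (hker : (A u).ker = D.range) {γ τ ρ : ℝ} (hγ : 0 < γ)
    (hgap : ∀ x, γ * ‖A u x‖ ^ 2 ≤ ‖ContinuousLinearMap.adjoint (A u) (A u x)‖ ^ 2) (hτ : 0 < τ)
    (hρ0 : 0 ≤ ρ) (hρ : ρ < 1)
    (h : ∀ x, ‖residualPropagator τ (A u) g (A u x)‖ ≤ ρ * ‖A u x‖) {G : ℕ → V → V}
    (hG : ∃ C : ℝ, ∀ᶠ w in 𝓝 u, ∀ n, ‖G n w - g‖ ≤ C * ‖w - u‖) {ε : ℝ} (hε : 0 < ε) :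
    ∃ δ : ℝ, 0 < δ ∧ ∀ w : ℕ → V, ‖w 0 - u‖ < δ →
      (∀ n, w (n + 1) = w n - τ • modePrecond τ (A (w n)) (G n (w n)) (F (w n))) →
        (∀ n, A (w n) (G n (w n)) ≠ 0) ∧
          ∃ c, ‖c - c₀‖ < ε ∧ F (U c) = 0 ∧ Tendsto w atTop (𝓝 (U c)) := by
  have hFu : F u = 0 := by
    rw [← hu]
    exact hFU.self_of_nhds
  obtain ⟨σ, hσ, hσK⟩ := hU.exists_orthogonal_parameter
  rw [hu] at hσ hσK
  have hκ : 0 < Real.sqrt γ := Real.sqrt_pos.2 hγ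
  have hp : Tendsto (fun w => U (σ w)) (𝓝 u) (𝓝 u) := by
    have := hU.continuousAt.tendsto.comp hσ
    rwa [hu] at this
  have hFp : ∀ᶠ w in 𝓝 u, F (U (σ w)) = 0 := hσ.eventually hFU
  have hlow : ∀ᶠ w in 𝓝 u, Real.sqrt γ * ‖w - U (σ w)‖ ≤ ‖A u (w - U (σ w))‖ := by
    filter_upwards [hσK] with w hw
    rw [← hker] at hw
    exact gap_mul_norm_le_of_mem_ker_orthogonal hγ hgap hw
  -- If both `w` and `U (σ w)` are zeros, strict differentiability gives `‖A (w - U (σ w))‖ ≤ (√γ /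
  -- 2) ‖w - U (σ w)‖`, against the lower bound with `√γ`.
  have hzero : ∀ᶠ w in 𝓝 u, F w = 0 → w = U (σ w) := by
    have c1 := hF.isLittleO.comp_tendsto (tendsto_id.prodMk_nhds hp)
    filter_upwards [c1.bound (half_pos hκ), hFp, hlow] with w h1 h2 h3 h4
    simp only [Function.comp_apply, id_eq, h2, h4, sub_zero, zero_sub, norm_neg] at h1
    have : ‖w - U (σ w)‖ = 0 := by
      nlinarith [norm_nonneg (w - U (σ w))]
    exact sub_eq_zero.1 (norm_eq_zero.1 this)
  have hgoodG := eventually_forall_modePrecond_step hF hFu hA hg hp hFp hκ hlow hτ hρ0 hρ h hG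
  have hσε : ∀ᶠ w in 𝓝 u, ‖σ w - c₀‖ < ε := by
    filter_upwards [hσ.eventually (Metric.ball_mem_nhds c₀ hε)] with w hw
    rwa [← dist_eq_norm]
  obtain ⟨r, hr, hball⟩ := Metric.eventually_nhds_iff.1
    (((hgoodG.and hzero).and (hσε.and hFp)).and hFc)
  simp only [dist_eq_norm] at hball
  set C := τ * (‖modePrecond τ (A u) g‖ + 1) with hC
  have hC0 : 0 ≤ C := by positivity
  have hstart : Tendsto (fun w => ‖w - u‖ + C * ‖F w‖ / (1 - (1 + ρ) / 2)) (𝓝 u) (𝓝 0) := by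
    have s1 : Tendsto (fun w => ‖w - u‖) (𝓝 u) (𝓝 0) := tendsto_norm_sub_self u
    have s2 : Tendsto (fun w => ‖F w‖) (𝓝 u) (𝓝 0) := by
      have := hF.continuousAt.tendsto.norm
      rwa [hFu, norm_zero] at this
    simpa using s1.add ((s2.const_mul C).div_const (1 - (1 + ρ) / 2))
  obtain ⟨δ, hδ, hδball⟩ := Metric.eventually_nhds_iff.1 (hstart.eventually_lt_const hr)
  refine ⟨δ, hδ, fun w hw0 hw => ?_⟩
  obtain ⟨hin, hres, l, hlr, hlim⟩ := exists_tendsto_of_residual_contraction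
    (f := fun w => ‖F w‖) (fun _ => norm_nonneg _) (u := u) (r := r) hC0
    (by linarith : 0 ≤ (1 + ρ) / 2) (by linarith) (w := w)
    (fun n hn => by
      obtain ⟨-, h2, h3⟩ := (hball hn).1.1.1 n
      refine ⟨?_, by rwa [hw n]⟩
      rw [hw n, sub_sub_cancel_left, norm_neg, norm_smul, Real.norm_of_nonneg hτ.le, hC, mul_assoc]
      gcongr
      exact ContinuousLinearMap.le_of_opNorm_le _ h2.le _)
    (hδball (by rwa [dist_eq_norm]))
  -- The limit also lies in the open ball, so continuity makes it a zero of `F` and `hz` places it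
  -- in the family.
  obtain ⟨⟨⟨-, hz⟩, hcε, hFl⟩, hcont⟩ := hball hlr
  have hFl0 : F l = 0 :=
    norm_eq_zero.1 (tendsto_nhds_unique (hcont.tendsto.comp hlim).norm hres)
  refine ⟨fun n => ((hball (hin n)).1.1.1 n).1, σ l, hcε, hFl, ?_⟩
  rwa [← hz hFl0]

end Iteration

/-! ### Translation to Hilbert-space operators on the energy space. -/

namespace AccelerationOperator

open ContinuousLinearMap

variable {H : Type*} [NormedAddCommGroup H] [InnerProductSpace ℝ H] [CompleteSpace H]
  (M : AccelerationOperator H) (L₀ : M.Energy → M.EnergyDual)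

theorem inner_inv (f : M.EnergyDual) (v : M.Energy) : ⟪M.inv f, v⟫ = f v := by
  rw [← M.toDual_apply]
  change M.toDual (M.toDual.symm f) v = f v
  rw [ContinuousLinearEquiv.apply_symm_apply]

theorem inv_eq_zero_iff (f : M.EnergyDual) : M.inv f = 0 ↔ f = 0 :=
  M.toDual.symm.map_eq_zero_iff

theorem toDual_self (v : M.Energy) : M.toDual v v = ‖v‖ ^ 2 := by
  rw [toDual_apply, real_inner_self_eq_norm_sq]

/-- The operator `M⁻¹ L₁` on the energy space. -/
noncomputable def invL₁ (w : M.Energy) : M.Energy →L[ℝ] M.Energy := M.inv ∘L M.L₁ L₀ w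

theorem ker_invL₁ (w : M.Energy) : (M.invL₁ L₀ w).ker = (M.L₁ L₀ w).ker := by
  ext v
  exact M.inv_eq_zero_iff _

theorem L₁_apply_inv (w v : M.Energy) (f : M.EnergyDual) :
    M.L₁ L₀ w v (M.inv f) = ⟪M.invL₁ L₀ w v, M.inv f⟫ :=
  (M.inner_inv _ _).symm

/-- `M⁻¹` represents functionals in the energy inner product, so the dual-pairing adjoint becomes
the Hilbert adjoint. -/
theorem inv_L₁adj (w y : M.Energy) : M.inv (M.L₁adj L₀ w y) = adjoint (M.invL₁ L₀ w) y := by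
  refine ext_inner_right ℝ fun v => ?_
  rw [inner_inv, adjoint_inner_left, real_inner_comm]
  exact (M.inner_inv (M.L₁ L₀ w v) y).symm

theorem calL_eq (w : M.Energy) :
    M.calL L₀ w = -(adjoint (M.invL₁ L₀ w) ∘L M.invL₁ L₀ w) := by
  ext v
  exact congrArg Neg.neg (M.inv_L₁adj L₀ w _)

theorem toDual_calL (w x y : M.Energy) :
    M.toDual x (M.calL L₀ w y) = -⟪M.invL₁ L₀ w x, M.invL₁ L₀ w y⟫ := by
  rw [toDual_apply, calL_eq]
  simp only [neg_apply, comp_apply, inner_neg_right, adjoint_inner_right]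

theorem L₁_apply_inv_self (w v : M.Energy) :
    M.L₁ L₀ w v (M.inv (M.L₁ L₀ w v)) = ‖M.invL₁ L₀ w v‖ ^ 2 := by
  rw [L₁_apply_inv, ← real_inner_self_eq_norm_sq]
  rfl

theorem alpha_eq (τ : ℝ) (w g : M.Energy) : M.alpha L₀ τ w g = modeCoeff τ (M.invL₁ L₀ w) g := by
  rw [alpha, modeCoeff, toDual_self, L₁_apply_inv_self]

/-- The opposite sign in `alpha₀` is absorbed by `⟨M g, 𝓛 g⟩ = -‖A g‖²`. -/
theorem alpha₀_eq (τ : ℝ) (w g : M.Energy) :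
    M.alpha₀ L₀ τ w g = modeCoeff τ (M.invL₁ L₀ w) g := by
  rw [alpha₀, modeCoeff, toDual_self, toDual_calL, real_inner_self_eq_norm_sq, neg_mul,
    div_neg, ← sub_eq_add_neg]

theorem msomStep_eq (τ : ℝ) (w g : M.Energy) :
    M.msomStep L₀ τ w g = w - τ • modePrecond τ (M.invL₁ L₀ w) g (M.inv (L₀ w)) := by
  have h : M.L₁adj L₀ w (M.inv (L₀ w)) g = ⟪M.invL₁ L₀ w g, M.inv (L₀ w)⟫ :=
    M.L₁_apply_inv L₀ w g (L₀ w)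
  rw [msomStep, modePrecond_apply, alpha_eq, inv_L₁adj, h]

theorem calLM_apply (τ : ℝ) (w g x : M.Energy) :
    M.calLM L₀ τ w g x = -modePrecond τ (M.invL₁ L₀ w) g (M.invL₁ L₀ w x) := by
  have h : M.calLM L₀ τ w g x =
      M.calL L₀ w x - M.alpha₀ L₀ τ w g • M.toDual g (M.calL L₀ w x) • g := rfl
  rw [h, toDual_calL, alpha₀_eq, calL_eq, modePrecond_apply]
  simp only [neg_apply, comp_apply]
  module

theorem isSelfAdjoint_calL (w : M.Energy) : IsSelfAdjoint (M.calL L₀ w) := by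
  rw [calL_eq]
  exact (isPositive_adjoint_comp_self _).isSelfAdjoint.neg

theorem norm_invL₁_sq_le (w x : M.Energy) :
    ‖M.invL₁ L₀ w x‖ ^ 2 ≤ -M.lamMin L₀ w * ‖x‖ ^ 2 := by
  have h := (M.isSelfAdjoint_calL L₀ w).sInf_spectrum_mul_norm_sq_le x
  rw [real_inner_comm, ← toDual_apply, toDual_calL, real_inner_self_eq_norm_sq] at h
  rw [lamMin]
  linarith

theorem SpectralGap.exists_gap {M : AccelerationOperator H} {L₀ : M.Energy → M.EnergyDual}
    {w : M.Energy} (h : M.SpectralGap L₀ w) :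
    ∃ γ : ℝ, 0 < γ ∧ ∀ x, γ * ‖M.invL₁ L₀ w x‖ ^ 2 ≤
      ‖adjoint (M.invL₁ L₀ w) (M.invL₁ L₀ w x)‖ ^ 2 := by
  obtain ⟨γ, hγ, hspec⟩ := h
  refine ⟨γ, hγ, fun x => ?_⟩
  have h1 := (M.isSelfAdjoint_calL L₀ w).neg.gap_mul_inner_le hγ (fun k hk hk0 => by
    rw [← spectrum.neg_eq, Set.mem_neg] at hk
    have := hspec _ hk (neg_ne_zero.2 hk0)
    linarith) x
  rw [calL_eq, neg_neg] at h1
  simpa only [comp_apply, adjoint_inner_left, real_inner_self_eq_norm_sq] using h1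

/-- The step bound in terms of the norms of `G` and `M⁻¹ L₁ G`. -/
theorem mul_lt_of_lt_stepBound {τ : ℝ} (hτ : 0 < τ) {w g : M.Energy}
    (h : ENNReal.ofReal τ < M.stepBound L₀ w g) :
    τ * -M.lamMin L₀ w < 2 ∧
      τ * (-M.lamMin L₀ w - ‖M.invL₁ L₀ w g‖ ^ 2 / ‖g‖ ^ 2) < 1 := by
  -- For `a ≤ 0` the extended quotient is `∞` and carries no information, but the real inequality is
  -- then trivial.
  have key : ∀ {a b : ℝ}, 0 < b → ENNReal.ofReal τ < ENNReal.ofReal b / ENNReal.ofReal a →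
      τ * a < b := by
    intro a b hb hab
    rcases le_or_gt a 0 with ha | ha
    · exact (mul_nonpos_of_nonneg_of_nonpos hτ.le ha).trans_lt hb
    · rw [← ENNReal.ofReal_div_of_pos ha, ENNReal.ofReal_lt_ofReal_iff (by positivity),
        lt_div_iff₀ ha] at hab
      exact hab
  rw [stepBound, lt_min_iff, toDual_calL, toDual_self, real_inner_self_eq_norm_sq] at h
  refine ⟨key two_pos (by simpa using h.1), key one_pos ?_⟩
  have e : -M.lamMin L₀ w - ‖M.invL₁ L₀ w g‖ ^ 2 / ‖g‖ ^ 2 =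
      -‖M.invL₁ L₀ w g‖ ^ 2 / ‖g‖ ^ 2 - M.lamMin L₀ w := by ring
  rw [e, ENNReal.ofReal_one]
  exact h.2

theorem KernelAssumption.ker_invL₁_eq_range {M : AccelerationOperator H}
    {L₀ : M.Energy → M.EnergyDual} {s : ℕ} {U : EuclideanSpace ℝ (Fin s) → M.Energy}
    {c₀ : EuclideanSpace ℝ (Fin s)} (h : M.KernelAssumption L₀ U c₀) :
    (M.invL₁ L₀ (U c₀)).ker = (fderiv ℝ U c₀).range := by
  rw [ker_invL₁, h.kernel, LinearMap.range_eq_map,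
    ← (EuclideanSpace.basisFun (Fin s) ℝ).toBasis.span_eq, Submodule.map_span, ← Set.range_comp]
  congr 2
  ext j
  simp

end AccelerationOperator

/-! ### The main theorem. -/

theorem theorem2 (N d : ℕ) (M : AccelerationOperator (L2Space N d))
    (L₀ : M.Energy → M.EnergyDual)
    (s : ℕ) (U : EuclideanSpace ℝ (Fin s) → M.Energy) (c₀ : EuclideanSpace ℝ (Fin s))
    (u : M.Energy) (hu : u = U c₀)
    (hL₀ : ContDiffAt ℝ 1 L₀ u)
    (hker : M.KernelAssumption L₀ U c₀)
    (hgap : M.SpectralGap L₀ u)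
    (G : ℕ → M.Energy → M.Energy) (G₀ : M.Energy)
    (hG : ∃ C : ℝ, ∀ᶠ w in 𝓝 u, ∀ n, ‖G n w - G₀‖ ≤ C * ‖w - u‖)
    (hG₀ : M.L₁ L₀ u G₀ ≠ 0)
    (Δt : ℝ) (hΔt_pos : 0 < Δt) (hΔt : ENNReal.ofReal Δt < M.stepBound L₀ u G₀) :
    -- the eigenvalues of the linearized iteration operator
    (∀ z : ℂ, AccelerationOperator.IsComplexEigenvalue
        (M.calLM L₀ Δt u G₀ : M.Energy →ₗ[ℝ] M.Energy) z →
      z.im = 0 ∧ z.re ≤ 0 ∧ (z ≠ 0 → ‖1 + z * (Δt : ℂ)‖ < 1)) ∧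
    -- its kernel, and the absence of generalized eigenfunctions at zero
    (M.calLM L₀ Δt u G₀).ker = (M.L₁ L₀ u).ker ∧
    (∀ F : M.Energy, M.calLM L₀ Δt u G₀ (M.calLM L₀ Δt u G₀ F) = 0 →
      M.calLM L₀ Δt u G₀ F = 0) ∧
    -- convergence of the method from nearby initial data
    (∀ ε : ℝ, 0 < ε → ∃ δ : ℝ, 0 < δ ∧ ∀ w : ℕ → M.Energy,
      ‖w 0 - u‖ < δ → M.IsMSOM L₀ Δt G w →
        (∀ n, M.toDual (G n (w n)) (G n (w n)) ≠ 0 ∧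
          M.L₁ L₀ (w n) (G n (w n)) (M.inv (M.L₁ L₀ (w n) (G n (w n)))) ≠ 0) ∧
        ∃ c : EuclideanSpace ℝ (Fin s), ‖c - c₀‖ < ε ∧ L₀ (U c) = 0 ∧
          Tendsto w atTop (𝓝 (U c))) := by
  set A := M.invL₁ L₀ with hA
  have hAG : A u G₀ ≠ 0 := fun h => hG₀ ((M.inv_eq_zero_iff _).1 h)
  obtain ⟨γ, hγ, hAγ⟩ := hgap.exists_gap
  obtain ⟨hb₁, hb₂⟩ := M.mul_lt_of_lt_stepBound L₀ hΔt_pos hΔt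
  obtain ⟨ρ, hρ0, hρ, hcontr⟩ := exists_norm_residualPropagator_le hAG hγ hAγ
    (M.norm_invL₁_sq_le L₀ u) hΔt_pos hb₁ hb₂
  have hLM := M.calLM_apply L₀ Δt u G₀
  have hzero : ∀ x, A u x = 0 → M.calLM L₀ Δt u G₀ x = 0 := fun x hx => by
    rw [hLM, ← hA, hx, map_zero, neg_zero]
  refine ⟨fun z hz => eigenvalue_of_norm_residualPropagator_le hΔt_pos hρ hcontr hLM hz, ?_, ?_, ?_⟩
  · rw [← M.ker_invL₁]
    ext x
    refine ⟨fun hx => ?_, hzero x⟩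
    have hx' : M.calLM L₀ Δt u G₀ x = 0 := hx
    rw [hLM, neg_eq_zero] at hx'
    exact eq_zero_of_apply_modePrecond_eq_zero hρ hcontr (by rw [hA, hx', map_zero])
  · intro F hF
    -- The kernel argument is used twice: `Q A (𝓛_M F) = 0` gives `A (𝓛_M F) = 0`, that is `A Q A F
    -- = 0`, and hence `A F = 0`.
    have h1 : A u (M.calLM L₀ Δt u G₀ F) = 0 := by
      rw [hLM, neg_eq_zero] at hF
      exact eq_zero_of_apply_modePrecond_eq_zero hρ hcontr (by rw [hA, hF, map_zero])
    rw [hLM, map_neg, neg_eq_zero] at h1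
    exact hzero F (eq_zero_of_apply_modePrecond_eq_zero hρ hcontr h1)
  · intro ε hε
    have hF : HasStrictFDerivAt (fun w => M.inv (L₀ w)) (A u) u :=
      M.inv.hasStrictFDerivAt.comp u (hL₀.hasStrictFDerivAt one_ne_zero)
    have hFc : ∀ᶠ w in 𝓝 u, ContinuousAt (fun w => M.inv (L₀ w)) w := by
      filter_upwards [hL₀.eventually (by simp)] with w hw
      exact M.inv.continuous.continuousAt.comp hw.continuousAt
    have hAc : ContinuousAt A u :=
      continuousAt_const.clm_comp (hL₀.continuousAt_fderiv one_ne_zero)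
    have hrange : (A u).ker = (fderiv ℝ U c₀).range := by
      rw [hu]
      exact hker.ker_invL₁_eq_range
    have hsol : ∀ᶠ c in 𝓝 c₀, M.inv (L₀ (U c)) = 0 := by
      filter_upwards [hker.solution] with c hc
      rw [hc, map_zero]
    obtain ⟨δ, hδ, hconv⟩ := exists_forall_tendsto_zero_family hF hFc hAc hAG
      (hker.smooth.hasStrictFDerivAt one_ne_zero) hu.symm hsol hrange hγ hAγ hΔt_pos hρ0 hρ hcontr
      hG hε
    refine ⟨δ, hδ, fun w hw0 hw => ?_⟩
    obtain ⟨hne, c, hc, hUc, hlim⟩ := hconv w hw0 fun n => by rw [hw n, M.msomStep_eq]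
    refine ⟨fun n => ⟨?_, ?_⟩, c, hc, (M.inv_eq_zero_iff _).1 hUc, hlim⟩
    · rw [M.toDual_self]
      exact pow_ne_zero 2 (norm_ne_zero_iff.2 fun h => hne n (by rw [h, map_zero]))
    · rw [M.L₁_apply_inv_self]
      exact pow_ne_zero 2 (norm_ne_zero_iff.2 (hne n))
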